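/- Let $1\le d'\le d$ and let $\mathcal M\subset\mathbb R^d$ be a compact embedded $d'$-dimensional $C^1$ submanifold, possibly with boundary. Let $\mu$ be a Borel probability measure on $\mathbb R^d$ whose support is $\mathcal M$, and assume that there is $f_0>0$ with $\mu\ge f_0\,\mathrm{vol}_{\mathcal M}$, where $\mathrm{vol}_{\mathcal M}$ is the $d'$-dimensional volume measure of $\mathcal M$ (for instance, $\mu$ has a density with respect to $\mathrm{vol}_{\mathcal M}$ that is bounded below by $f_0$). For probability measures $\nu,\nu'$ on $\mathbb R^d$ let $W_2(\nu,\nu')=\inf_\pi\left(\int\|x-y\|^2\,d\pi(x,y)\right)^{1/2}$, the infimum being over all measures $\pi$ on $\mathbb R^d\times\mathbb R^d$ with marginals $\nu$ and $\nu'$. Let $\delta_{\nu,m}(x)=\inf\{r>0:\nu(\bar B(x,r))>m\}$, let $d_{\nu,m_0}(x)=\left(\frac1{m_0}\int_0^{m_0}\delta_{\nu,m}(x)^2\,dm\right)^{1/2}$ for $0<m_0\le 1$, and let $d_{\mathcal M}(x)=\inf_{y\in\mathcal M}\|x-y\|$. Then there is a constant $C(\mu)>0$, depending only on $\mu$, such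 that the following holds. Let $\mu_R$ be the uniform probability measure on any closed ball of radius $R>0$ that contains $\mathcal M$, let $n\ge1$, $\alpha_n\in[0,1]$, $m_n\in(0,1]$, let $\mu_n'=(1-\alpha_n)\mu+\alpha_n\mu_R$, let $X_1,\dots,X_n$ be an independent sample from $\mu_n'$, and let $\widehat{\mu}_n'=\frac1n\sum_{i=1}^n\delta_{X_i}$ be its empirical measure. Then, for every realization of the sample, $$\|d_{\mathcal M}-d_{\widehat{\mu}_n',m_n}\|_\infty\le C(\mu)^{1/d'}m_n^{1/d'}+\left(\frac{\alpha_n}{m_n}\right)^{1/2}W_2(\mu,\mu_R)+m_n^{-1/2}\,W_2(\mu_n',\widehat{\mu}_n'),$$ where $\|g\|_\infty=\sup_{x\in\mathbb R^d}|g(x)|$. -/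

import Mathlib

open MeasureTheory Set
open scoped ENNReal NNReal

noncomputable section

/-- A transport plan between `μ` and `ν`: a measure on the product with marginals `μ` and `ν`. -/
def IsTransportPlan {X : Type*} [MeasurableSpace X] (π : Measure (X × X)) (μ ν : Measure X) :
    Prop :=
  π.fst = μ ∧ π.snd = ν

/-- The quadratic cost `(∫ dist(x, y)² dπ(x, y))^(1/2)` of a transport plan. -/
def transportCost {X : Type*} [MeasurableSpace X] [PseudoEMetricSpace X]
    (π : Measure (X × X)) : ℝ≥0∞ :=
  (∫⁻ p, edist p.1 p.2 ^ 2 ∂π) ^ (1 / 2 : ℝ)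

/-- The Wasserstein distance `W₂`, with values in `[0, ∞]`. -/
def wasserstein2 {X : Type*} [MeasurableSpace X] [PseudoEMetricSpace X] (μ ν : Measure X) :
    ℝ≥0∞ :=
  ⨅ (π : Measure (X × X)) (_ : IsTransportPlan π μ ν), transportCost π

/-- `δ_{μ,m}(x) = inf {r > 0 : μ (closed ball of centre x and radius r) > m}`. -/
def pseudoDist {X : Type*} [MeasurableSpace X] [PseudoMetricSpace X]
    (μ : Measure X) (m : ℝ) (x : X) : ℝ :=
  sInf {r : ℝ | 0 < r ∧ ENNReal.ofReal m < μ (Metric.closedBall x r)}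

/-- The distance to the measure `μ` with mass parameter `m₀`:
`d_{μ,m₀}(x) = ((1 / m₀) ∫₀^{m₀} δ_{μ,m}(x)² dm)^(1/2)`. -/
def distToMeasure {X : Type*} [MeasurableSpace X] [PseudoMetricSpace X]
    (μ : Measure X) (m₀ : ℝ) (x : X) : ℝ :=
  Real.sqrt ((1 / m₀) * ∫ m in (0 : ℝ)..m₀, pseudoDist μ m x ^ 2)

/-- The mixture `(1 - α) μ + α ν`. -/
def mixture {X : Type*} [MeasurableSpace X] (α : ℝ) (μ ν : Measure X) : Measure X :=
  ENNReal.ofReal (1 - α) • μ + ENNReal.ofReal α • ν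

/-- The empirical measure `(1 / n) ∑ᵢ δ_{xᵢ}` of `n` points. -/
def empiricalMeasure {X : Type*} [MeasurableSpace X] {n : ℕ} (x : Fin n → X) : Measure X :=
  (n : ℝ≥0∞)⁻¹ • ∑ i, Measure.dirac (x i)

/-- The uniform probability measure on the closed ball of centre `c` and radius `R`. -/
def uniformBall {d : ℕ} (c : EuclideanSpace ℝ (Fin d)) (R : ℝ) :
    Measure (EuclideanSpace ℝ (Fin d)) :=
  ProbabilityTheory.cond volume (Metric.closedBall c R)

/-- The coordinate subspace `ℝᵏ × {0}` of `ℝᵈ`. -/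
def coordSlice (d k : ℕ) : Set (EuclideanSpace ℝ (Fin d)) :=
  {y | ∀ i : Fin d, k ≤ (i : ℕ) → y i = 0}

/-- The half-space of `ℝᵏ × {0}` on which the first coordinate is non-negative. -/
def coordHalfSlice (d k : ℕ) : Set (EuclideanSpace ℝ (Fin d)) :=
  {y | y ∈ coordSlice d k ∧ ∀ i : Fin d, (i : ℕ) = 0 → 0 ≤ y i}

/-- `M` is an embedded `k`-dimensional `C¹` submanifold of `ℝᵈ`, possibly with boundary: around
each of its points a local `C¹` diffeomorphism of `ℝᵈ` carries `M` to `ℝᵏ × {0}` or to a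
half-space of it. -/
def IsSubmanifoldWithBoundary {d : ℕ} (k : ℕ) (M : Set (EuclideanSpace ℝ (Fin d))) : Prop :=
  k ≤ d ∧ ∀ x ∈ M,
    ∃ Φ : OpenPartialHomeomorph (EuclideanSpace ℝ (Fin d)) (EuclideanSpace ℝ (Fin d)),
      x ∈ Φ.source ∧ ContDiffOn ℝ 1 Φ Φ.source ∧ ContDiffOn ℝ 1 Φ.symm Φ.target ∧
        (Φ.IsImage M (coordSlice d k) ∨ Φ.IsImage M (coordHalfSlice d k))

/-- `μ` dominates a positive multiple of the `k`-dimensional volume measure of `M`. When `μ` has a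
density with respect to that measure, this says that the density is bounded below on `M` by some
`f₀ > 0`, almost everywhere. -/
def DensityBoundedBelow {d : ℕ} (k : ℕ) (M : Set (EuclideanSpace ℝ (Fin d)))
    (μ : Measure (EuclideanSpace ℝ (Fin d))) : Prop :=
  ∃ f₀ : ℝ≥0, 0 < f₀ ∧ f₀ • (Measure.euclideanHausdorffMeasure k).restrict M ≤ μ

end

/-! The error splits by the triangle inequality through `d_{μ,m}` and `d_{μ',m}`, with `μ'` the
mixture.

For the first piece, bi-Lipschitz charts and compactness give `μ(B̄(y,r)) ≥ c r^k` for `y ∈ M` and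
small `r`, where `k = d'`. Enlarging the constant to cover large radii, every ball centred on `M` of
radius above `(C m)^(1/k)` has mass more than any `l < m`
(`DensityBoundedBelow.exists_lt_measure_closedBall`). A ball about `x` of radius `d_M(x)` is null,
and enlarging that radius reaches such a ball about a nearest point of `M`, so `δ_{μ,l}(x)` lies
between `d_M(x)` and `d_M(x) + (C m)^(1/k)`. Averaging preserves these bounds
(`abs_infDist_sub_distToMeasure_le`).

The other two pieces use `W₂`-stability (`abs_distToMeasure_sub_le`): `√m · d_{ν,m}(x)` is the least
`L²` norm of the distance to `x` over submeasures of `ν` of mass `m`. Restricting a plan to an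
optimal submeasure and applying Minkowski bounds the change by the transport cost. Moving only the
fraction `α` of mass gives `W₂(μ, μ') ≤ √α · W₂(μ, μ_R)` (`wasserstein2_mixture_le`). -/

/-! ### Volume growth of balls centred on a compact submanifold -/

theorem LipschitzOnWith.euclideanHausdorffMeasure_image_le {X Y : Type*}
    [MetricSpace X] [MeasurableSpace X] [BorelSpace X]
    [MetricSpace Y] [MeasurableSpace Y] [BorelSpace Y]
    {K : ℝ≥0} {f : X → Y} {s : Set X} (h : LipschitzOnWith K f s) (k : ℕ) :
    Measure.euclideanHausdorffMeasure k (f '' s) ≤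
      (K : ℝ≥0∞) ^ k * Measure.euclideanHausdorffMeasure k s := by
  simp only [Measure.euclideanHausdorffMeasure_def, Measure.smul_apply, ENNReal.smul_def,
    smul_eq_mul]
  have := h.hausdorffMeasure_image_le (d := (k : ℝ)) (by positivity)
  rw [ENNReal.rpow_natCast] at this
  rw [mul_left_comm]
  gcongr

/-- The inclusion of `ℝᵏ` as the first `k` coordinates of `ℝᵏ⁺ʲ`. -/
noncomputable def coordInclusion (k j : ℕ) (v : EuclideanSpace ℝ (Fin k)) :
    EuclideanSpace ℝ (Fin (k + j)) :=
  WithLp.toLp 2 (Fin.append (fun i => v i) (fun _ => 0))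

theorem isometry_coordInclusion (k j : ℕ) : Isometry (coordInclusion k j) := by
  refine Isometry.of_dist_eq fun v w => ?_
  simp [EuclideanSpace.dist_eq, coordInclusion, Fin.sum_univ_add]

theorem coordInclusion_mem_coordSlice {k j : ℕ} (v : EuclideanSpace ℝ (Fin k)) :
    coordInclusion k j v ∈ coordSlice (k + j) k := by
  intro i
  refine Fin.addCases (fun i hi => ?_) (fun i hi => ?_) i
  · simp at hi
    omega
  · simp [coordInclusion]

theorem exists_coordInclusion_eq {k j : ℕ} {z : EuclideanSpace ℝ (Fin (k + j))}
    (hz : z ∈ coordSlice (k + j) k) : ∃ v, coordInclusion k j v = z := by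
  refine ⟨WithLp.toLp 2 fun i => z (Fin.castAdd j i), ?_⟩
  ext i
  refine Fin.addCases (fun i => ?_) (fun i => ?_) i
  · simp [coordInclusion]
  · simpa [coordInclusion] using (hz (Fin.natAdd k i) (by simp)).symm

theorem volume_closedBall_le_coordInclusion {k j : ℕ} (w : EuclideanSpace ℝ (Fin k)) (r : ℝ)
    {T : Set (EuclideanSpace ℝ (Fin (k + j)))}
    (hT : ∀ v ∈ Metric.closedBall w r, coordInclusion k j v ∈ T) :
    volume (Metric.closedBall (0 : EuclideanSpace ℝ (Fin k)) r) ≤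
      Measure.euclideanHausdorffMeasure k T := by
  rw [← Measure.addHaar_closedBall_center volume w r,
    ← EuclideanSpace.euclideanHausdorffMeasure_eq_volume,
    ← (isometry_coordInclusion k j).euclideanHausdorffMeasure_image]
  exact measure_mono (image_subset_iff.2 hT)

theorem volume_closedBall_le_slice {d k : ℕ} (hkd : k ≤ d)
    {z : EuclideanSpace ℝ (Fin d)} (hz : z ∈ coordSlice d k) {s : ℝ} (hs : 0 < s) :
    volume (Metric.closedBall (0 : EuclideanSpace ℝ (Fin k)) (s / 2)) ≤
      Measure.euclideanHausdorffMeasure k (Metric.closedBall z s ∩ coordSlice d k) := by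
  obtain ⟨j, rfl⟩ := Nat.exists_eq_add_of_le hkd
  obtain ⟨v, rfl⟩ := exists_coordInclusion_eq hz
  refine volume_closedBall_le_coordInclusion v _ fun u hu =>
    ⟨?_, coordInclusion_mem_coordSlice u⟩
  rw [Metric.mem_closedBall, (isometry_coordInclusion k j).dist_eq]
  have := Metric.mem_closedBall.1 hu
  linarith

/-- Since `z` may lie on the boundary, the inscribed `k`-ball is centred at `z` pushed inward by `s
/ 2` along the first coordinate. Radius `s / 2` then keeps it both in the half-space and within
distance `s` of `z`. -/
theorem volume_closedBall_le_halfSlice {d k : ℕ} (hk : 1 ≤ k) (hkd : k ≤ d)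
    {z : EuclideanSpace ℝ (Fin d)} (hz : z ∈ coordHalfSlice d k) {s : ℝ} (hs : 0 < s) :
    volume (Metric.closedBall (0 : EuclideanSpace ℝ (Fin k)) (s / 2)) ≤
      Measure.euclideanHausdorffMeasure k (Metric.closedBall z s ∩ coordHalfSlice d k) := by
  obtain ⟨j, rfl⟩ := Nat.exists_eq_add_of_le hkd
  obtain ⟨hz, hz0⟩ := hz
  obtain ⟨v, rfl⟩ := exists_coordInclusion_eq hz
  let i₀ : Fin k := ⟨0, hk⟩
  let e : EuclideanSpace ℝ (Fin k) := EuclideanSpace.single i₀ (s / 2)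
  have he : dist (v + e) v = s / 2 := by
    rw [dist_self_add_left, PiLp.norm_single, Real.norm_of_nonneg (by positivity)]
  refine volume_closedBall_le_coordInclusion (v + e) _ fun u hu =>
    ⟨?_, coordInclusion_mem_coordSlice u, fun i hi => ?_⟩
  · rw [Metric.mem_closedBall, (isometry_coordInclusion k j).dist_eq]
    have := Metric.mem_closedBall.1 hu
    linarith [dist_triangle u (v + e) v]
  · obtain rfl : i = Fin.castAdd j i₀ := Fin.ext hi
    have h0 : 0 ≤ v i₀ := by simpa [coordInclusion] using hz0 (Fin.castAdd j i₀) rfl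
    have h1 : |u i₀ - (v i₀ + s / 2)| ≤ s / 2 := by
      have := (PiLp.norm_apply_le (u - (v + e)) i₀).trans
        ((dist_eq_norm u (v + e)).symm.le.trans (Metric.mem_closedBall.1 hu))
      simpa [e] using this
    have h2 : 0 ≤ u i₀ := by linarith [(abs_le.1 h1).1]
    simpa [coordInclusion] using h2

/-- The Lipschitz inverse chart sends a flat piece of radius `r / L₂` into the `r`-ball of `M`. The
chart, being `L₁`-Lipschitz, recovers that piece at the price of a factor `L₁ ^ k` in volume. -/
theorem IsSubmanifoldWithBoundary.exists_le_hausdorffMeasure_closedBall {d k : ℕ} (hk : 1 ≤ k)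
    {M : Set (EuclideanSpace ℝ (Fin d))} (hM : IsSubmanifoldWithBoundary k M)
    {x : EuclideanSpace ℝ (Fin d)} (hx : x ∈ M) :
    ∃ c : ℝ, 0 < c ∧ ∃ r₀ : ℝ, 0 < r₀ ∧ ∀ y ∈ Metric.ball x r₀ ∩ M, ∀ r, 0 < r → r ≤ r₀ →
      ENNReal.ofReal (c * r ^ k) ≤
        Measure.euclideanHausdorffMeasure k (Metric.closedBall y r ∩ M) := by
  obtain ⟨hkd, hM⟩ := hM
  obtain ⟨Φ, hxs, hΦ, hΨ, himg⟩ := hM x hx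
  obtain ⟨S, hS, hvol⟩ : ∃ S, Φ.IsImage M S ∧ ∀ z ∈ S, ∀ s : ℝ, 0 < s →
      volume (Metric.closedBall (0 : EuclideanSpace ℝ (Fin k)) (s / 2)) ≤
        Measure.euclideanHausdorffMeasure k (Metric.closedBall z s ∩ S) := by
    rcases himg with h | h
    · exact ⟨_, h, fun z hz s hs => volume_closedBall_le_slice hkd hz hs⟩
    · exact ⟨_, h, fun z hz s hs => volume_closedBall_le_halfSlice hk hkd hz hs⟩
  have hxt : Φ x ∈ Φ.target := Φ.map_source hxs
  obtain ⟨K₁, t₁, ht₁, hK₁⟩ :=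
    (hΦ.contDiffAt (Φ.open_source.mem_nhds hxs)).exists_lipschitzOnWith
  obtain ⟨K₂, t₂, ht₂, hK₂⟩ :=
    (hΨ.contDiffAt (Φ.open_target.mem_nhds hxt)).exists_lipschitzOnWith
  have hN : Φ.target ∩ t₂ ∩ Φ.symm ⁻¹' t₁ ∈ nhds (Φ x) := by
    refine Filter.inter_mem (Filter.inter_mem (Φ.open_target.mem_nhds hxt) ht₂) ?_
    refine (Φ.symm.continuousAt hxt).preimage_mem_nhds ?_
    rwa [Φ.left_inv hxs]
  obtain ⟨ε, hε, hεN⟩ := Metric.mem_nhds_iff.1 hN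
  have hN' : Φ.source ∩ Φ ⁻¹' Metric.ball (Φ x) (ε / 2) ∈ nhds x :=
    Filter.inter_mem (Φ.open_source.mem_nhds hxs)
      ((Φ.continuousAt hxs).preimage_mem_nhds (Metric.ball_mem_nhds _ (by positivity)))
  obtain ⟨ρ, hρ, hρN⟩ := Metric.mem_nhds_iff.1 hN'
  obtain ⟨v, hv0, hv⟩ : ∃ v : ℝ, 0 < v ∧ ∀ s : ℝ, 0 ≤ s →
      volume (Metric.closedBall (0 : EuclideanSpace ℝ (Fin k)) s) = ENNReal.ofReal (s ^ k * v) := by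
    have htop : volume (Metric.ball (0 : EuclideanSpace ℝ (Fin k)) 1) ≠ ∞ :=
      measure_ball_lt_top.ne
    refine ⟨(volume (Metric.ball (0 : EuclideanSpace ℝ (Fin k)) 1)).toReal,
      ENNReal.toReal_pos (Metric.measure_ball_pos _ _ one_pos).ne' htop, fun s hs => ?_⟩
    rw [Measure.addHaar_closedBall _ _ hs, finrank_euclideanSpace_fin,
      ENNReal.ofReal_mul (by positivity), ENNReal.ofReal_toReal htop]
  obtain ⟨L₁, hL₁, hKL₁⟩ : ∃ L : ℝ≥0, (1 : ℝ) ≤ L ∧ K₁ ≤ L :=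
    ⟨max 1 K₁, by exact_mod_cast le_max_left 1 K₁, le_max_right _ _⟩
  obtain ⟨L₂, hL₂, hKL₂⟩ : ∃ L : ℝ≥0, (1 : ℝ) ≤ L ∧ (K₂ : ℝ) ≤ L :=
    ⟨max 1 K₂, by exact_mod_cast le_max_left 1 K₂, by exact_mod_cast le_max_right 1 K₂⟩
  -- The factor `2` comes from the inscribed ball of radius `s / 2`, `L₂` from `s = r / L₂`, and
  -- `L₁` from mapping back. Two halves of `ε`, one for `Φ y` and one for `s ≤ r`, keep the flat
  -- piece where both Lipschitz bounds hold.
  refine ⟨v / (2 * L₂ * L₁) ^ k, by positivity, min ρ (ε / 2), by positivity, ?_⟩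
  rintro y ⟨hyx, hyM⟩ r hr hrr
  obtain ⟨hys, hyε⟩ := hρN (Metric.ball_subset_ball (min_le_left _ _) hyx)
  have hzS : Φ y ∈ S := (hS hys).2 hyM
  set s : ℝ := r / L₂ with hs
  have hs0 : 0 < s := by positivity
  have hsr : s ≤ r := div_le_self hr.le hL₂
  have hA : Metric.closedBall (Φ y) s ∩ S ⊆ Φ.target ∩ t₂ ∩ Φ.symm ⁻¹' t₁ := by
    rintro w ⟨hw, -⟩
    apply hεN
    have h1 := Metric.mem_closedBall.1 hw
    have h2 : dist (Φ y) (Φ x) < ε / 2 := hyε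
    have h3 := hrr.trans (min_le_right _ _)
    rw [Metric.mem_ball]
    linarith [dist_triangle w (Φ y) (Φ x)]
  have hy₂ : Φ y ∈ t₂ := (hA ⟨Metric.mem_closedBall_self hs0.le, hzS⟩).1.2
  have himage : Φ.symm '' (Metric.closedBall (Φ y) s ∩ S) ⊆ Metric.closedBall y r ∩ M := by
    rintro _ ⟨w, hw, rfl⟩
    refine ⟨?_, (hS.symm_apply_mem_iff (hA hw).1.1).2 hw.2⟩
    have h1 := hK₂.dist_le_mul w (hA hw).1.2 (Φ y) hy₂
    rw [Φ.left_inv hys] at h1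
    rw [Metric.mem_closedBall]
    calc dist (Φ.symm w) y ≤ K₂ * dist w (Φ y) := h1
      _ ≤ L₂ * s := by gcongr; exact hw.1
      _ = r := by rw [hs]; field_simp
  have hback : Φ '' (Φ.symm '' (Metric.closedBall (Φ y) s ∩ S)) = Metric.closedBall (Φ y) s ∩ S := by
    rw [image_image]
    exact (image_congr fun w hw => Φ.right_inv (hA hw).1.1).trans (image_id' _)
  have hlip : LipschitzOnWith L₁ Φ (Φ.symm '' (Metric.closedBall (Φ y) s ∩ S)) := by
    refine (hK₁.mono ?_).weaken hKL₁
    rintro _ ⟨w, hw, rfl⟩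
    exact (hA hw).2
  have hle := hlip.euclideanHausdorffMeasure_image_le k
  rw [hback] at hle
  have key := (hvol _ hzS s hs0).trans (hle.trans (mul_le_mul_right (measure_mono himage) _))
  rw [hv _ (by positivity)] at key
  have hL₁' : ENNReal.ofReal ((L₁ : ℝ) ^ k) = (L₁ : ℝ≥0∞) ^ k := by
    rw [ENNReal.ofReal_pow (by positivity), ENNReal.ofReal_coe_nnreal]
  rw [← ENNReal.mul_le_mul_iff_right (a := (L₁ : ℝ≥0∞) ^ k)
    (pow_ne_zero _ (ENNReal.coe_ne_zero.2 (by rintro rfl; norm_num at hL₁)))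
    (by simp), ← hL₁', ← ENNReal.ofReal_mul (by positivity), hL₁']
  refine le_trans (ENNReal.ofReal_le_ofReal (le_of_eq ?_)) key
  rw [hs]
  simp only [mul_pow, div_pow]
  field_simp

/-- A measure that dominates the volume measure of a compact submanifold is bounded below on small
balls by a multiple of the power of the radius. -/
theorem DensityBoundedBelow.exists_le_measure_closedBall {d k : ℕ} (hk : 1 ≤ k)
    {M : Set (EuclideanSpace ℝ (Fin d))} (hMc : IsCompact M)
    (hM : IsSubmanifoldWithBoundary k M) {μ : Measure (EuclideanSpace ℝ (Fin d))}
    (hμ : DensityBoundedBelow k M μ) :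
    ∃ c : ℝ, 0 < c ∧ ∃ r₀ : ℝ, 0 < r₀ ∧ ∀ y ∈ M, ∀ r, 0 < r → r ≤ r₀ →
      ENNReal.ofReal (c * r ^ k) ≤ μ (Metric.closedBall y r) := by
  obtain ⟨f, hf, hfμ⟩ := hμ
  -- The repeated `y ∈ M` is the case `S = M` of the predicate used for compact induction.
  suffices h : ∃ c : ℝ, 0 < c ∧ ∃ r₀ : ℝ, 0 < r₀ ∧ ∀ y ∈ M, y ∈ M → ∀ r, 0 < r → r ≤ r₀ →
      ENNReal.ofReal (c * r ^ k) ≤ μ (Metric.closedBall y r) by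
    obtain ⟨c, hc, r₀, hr₀, h⟩ := h
    exact ⟨c, hc, r₀, hr₀, fun y hy => h y hy hy⟩
  refine hMc.induction_on (p := fun S => ∃ c : ℝ, 0 < c ∧ ∃ r₀ : ℝ, 0 < r₀ ∧ ∀ y ∈ S, y ∈ M →
    ∀ r, 0 < r → r ≤ r₀ → ENNReal.ofReal (c * r ^ k) ≤ μ (Metric.closedBall y r))
    ⟨1, one_pos, 1, one_pos, by simp⟩ ?_ ?_ ?_
  · rintro s t hst ⟨c, hc, r₀, hr₀, h⟩
    exact ⟨c, hc, r₀, hr₀, fun y hy => h y (hst hy)⟩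
  · rintro s t ⟨c, hc, r₀, hr₀, h⟩ ⟨c', hc', r₀', hr₀', h'⟩
    refine ⟨min c c', lt_min hc hc', min r₀ r₀', lt_min hr₀ hr₀', ?_⟩
    rintro y (hy | hy) hyM r hr hrr
    · refine le_trans (ENNReal.ofReal_le_ofReal ?_) (h y hy hyM r hr (hrr.trans (min_le_left _ _)))
      gcongr
      exact min_le_left _ _
    · refine le_trans (ENNReal.ofReal_le_ofReal ?_)
        (h' y hy hyM r hr (hrr.trans (min_le_right _ _)))
      gcongr
      exact min_le_right _ _
  · intro x hx
    obtain ⟨c, hc, r₀, hr₀, h⟩ := hM.exists_le_hausdorffMeasure_closedBall hk hx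
    refine ⟨Metric.ball x r₀, mem_nhdsWithin_of_mem_nhds (Metric.ball_mem_nhds _ hr₀), f * c,
      by positivity, r₀, hr₀, fun y hy hyM r hr hrr => ?_⟩
    refine le_trans ?_ (hfμ _)
    rw [Measure.smul_apply, Measure.restrict_apply Metric.isClosed_closedBall.measurableSet,
      ENNReal.smul_def, smul_eq_mul, mul_assoc, ENNReal.ofReal_mul (by positivity),
      ENNReal.ofReal_coe_nnreal]
    gcongr
    exact h y ⟨hy, hyM⟩ r hr hrr

/-- Lower mass bound at all scales: a ball of radius `s` centred on the support has mass more than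
`l` as soon as `s ^ k > C l`. -/
theorem DensityBoundedBelow.exists_lt_measure_closedBall {d k : ℕ} (hk : 1 ≤ k)
    {M : Set (EuclideanSpace ℝ (Fin d))} (hMc : IsCompact M)
    (hM : IsSubmanifoldWithBoundary k M) {μ : Measure (EuclideanSpace ℝ (Fin d))}
    [IsProbabilityMeasure μ] (hμ : DensityBoundedBelow k M μ) (hMμ : ∀ᵐ y ∂μ, y ∈ M) :
    ∃ C : ℝ, 0 < C ∧ ∀ y ∈ M, ∀ l s : ℝ, 0 < l → l < 1 → 0 < s → C * l < s ^ k →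
      ENNReal.ofReal l < μ (Metric.closedBall y s) := by
  obtain ⟨c, hc, r₀, hr₀, h⟩ := hμ.exists_le_measure_closedBall hk hMc hM
  obtain ⟨D, hD0, hD⟩ : ∃ D : ℝ, 0 < D ∧ ∀ y ∈ M, M ⊆ Metric.closedBall y D :=
    ⟨Metric.diam M + 1, by positivity, fun y hy z hz => by
      have := Metric.dist_le_diam_of_mem hMc.isBounded hz hy
      rw [Metric.mem_closedBall]; linarith⟩
  -- The first term handles `s ≤ r₀`. The second handles `s > r₀` with `l ≥ c * r₀ ^ k`: it forces
  -- `s > D`, so the ball contains all of `M`. For smaller `l`, the ball of radius `r₀` already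
  -- suffices.
  refine ⟨1 / c + D ^ k / (c * r₀ ^ k), by positivity, fun y hy l s hl hl1 hs hls => ?_⟩
  rw [add_mul] at hls
  have hp1 : 0 < 1 / c * l := by positivity
  have hp2 : 0 < D ^ k / (c * r₀ ^ k) * l := by positivity
  rcases le_or_gt s r₀ with hsr | hsr
  · refine lt_of_lt_of_le ((ENNReal.ofReal_lt_ofReal_iff (by positivity)).2 ?_) (h y hy s hs hsr)
    calc l = c * (1 / c * l) := by field_simp
      _ < c * s ^ k := by gcongr; linarith
  · rcases lt_or_ge l (c * r₀ ^ k) with hlc | hlc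
    · exact lt_of_lt_of_le ((ENNReal.ofReal_lt_ofReal_iff (by positivity)).2 hlc)
        ((h y hy r₀ hr₀ le_rfl).trans (measure_mono (Metric.closedBall_subset_closedBall hsr.le)))
    · have hDs : D ^ k < s ^ k := by
        calc D ^ k = D ^ k / (c * r₀ ^ k) * (c * r₀ ^ k) := by field_simp
          _ ≤ D ^ k / (c * r₀ ^ k) * l := by gcongr
          _ < s ^ k := by linarith
      have hDs' : D < s := lt_of_pow_lt_pow_left₀ k hs.le hDs
      have : μ (Metric.closedBall y s) = 1 := by
        rw [← prob_compl_eq_zero_iff Metric.isClosed_closedBall.measurableSet]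
        exact mem_ae_iff.1 (hMμ.mono fun z hz =>
          Metric.closedBall_subset_closedBall hDs'.le (hD y hy hz))
      rw [this]
      simpa using hl1

/-! ### Layer-cake comparison of second moments -/

/-- Layer-cake formula. Strict superlevel sets of a distance are complements of closed balls; the
non-strict variant below pairs with open balls. -/
theorem lintegral_ofReal_sq_le_of_measure_lt_le {α β : Type*} [MeasurableSpace α]
    [MeasurableSpace β] {μ : Measure α} {ν : Measure β} {f : α → ℝ} {g : β → ℝ}
    (hf0 : ∀ a, 0 ≤ f a) (hf : AEMeasurable f μ) (hg0 : ∀ b, 0 ≤ g b) (hg : AEMeasurable g ν)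
    (h : ∀ t, 0 < t → μ {a | t < f a} ≤ ν {b | t < g b}) :
    ∫⁻ a, ENNReal.ofReal (f a ^ 2) ∂μ ≤ ∫⁻ b, ENNReal.ofReal (g b ^ 2) ∂ν := by
  have h1 := lintegral_rpow_eq_lintegral_meas_lt_mul μ (ae_of_all _ hf0) hf two_pos
  have h2 := lintegral_rpow_eq_lintegral_meas_lt_mul ν (ae_of_all _ hg0) hg two_pos
  simp only [Real.rpow_ofNat] at h1 h2
  rw [h1, h2]
  gcongr ENNReal.ofReal 2 * ?_
  refine setLIntegral_mono' measurableSet_Ioi fun t ht => ?_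
  gcongr
  exact h t ht

theorem lintegral_ofReal_sq_le_of_measure_le_le {α β : Type*} [MeasurableSpace α]
    [MeasurableSpace β] {μ : Measure α} {ν : Measure β} {f : α → ℝ} {g : β → ℝ}
    (hf0 : ∀ a, 0 ≤ f a) (hf : AEMeasurable f μ) (hg0 : ∀ b, 0 ≤ g b) (hg : AEMeasurable g ν)
    (h : ∀ t, 0 < t → μ {a | t ≤ f a} ≤ ν {b | t ≤ g b}) :
    ∫⁻ a, ENNReal.ofReal (f a ^ 2) ∂μ ≤ ∫⁻ b, ENNReal.ofReal (g b ^ 2) ∂ν := by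
  have h1 := lintegral_rpow_eq_lintegral_meas_le_mul μ (ae_of_all _ hf0) hf two_pos
  have h2 := lintegral_rpow_eq_lintegral_meas_le_mul ν (ae_of_all _ hg0) hg two_pos
  simp only [Real.rpow_ofNat] at h1 h2
  rw [h1, h2]
  gcongr ENNReal.ofReal 2 * ?_
  refine setLIntegral_mono' measurableSet_Ioi fun t ht => ?_
  gcongr
  exact h t ht

/-! ### The radius `δ_{ν,m}(x)` as a quantile function -/

section Quantile

variable {X : Type*} [MeasurableSpace X] [PseudoMetricSpace X]
  {ν : Measure X} {x : X}

theorem pseudoDist_nonneg (ν : Measure X) (l : ℝ) (x : X) : 0 ≤ pseudoDist ν l x :=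
  Real.sInf_nonneg fun _ hr => hr.1.le

theorem pseudoDist_le {l t : ℝ} (ht : 0 < t)
    (h : ENNReal.ofReal l < ν (Metric.closedBall x t)) : pseudoDist ν l x ≤ t :=
  csInf_le ⟨0, fun _ hr => hr.1.le⟩ ⟨ht, h⟩

theorem exists_closedBall_eq_one [OpensMeasurableSpace X] [IsProbabilityMeasure ν]
    (hB : ∃ r, ∀ᵐ y ∂ν, dist y x ≤ r) : ∃ r, 0 < r ∧ ν (Metric.closedBall x r) = 1 := by
  obtain ⟨r, hr⟩ := hB
  refine ⟨max r 1, by positivity, ?_⟩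
  rw [← prob_compl_eq_zero_iff Metric.isClosed_closedBall.measurableSet]
  exact mem_ae_iff.1 (hr.mono fun y hy => Metric.mem_closedBall.2 (hy.trans (le_max_left _ _)))

variable [OpensMeasurableSpace X] [IsProbabilityMeasure ν]

theorem pseudoDist_set_nonempty (hB : ∃ r, ∀ᵐ y ∂ν, dist y x ≤ r) {l : ℝ} (hl : l < 1) :
    {r : ℝ | 0 < r ∧ ENNReal.ofReal l < ν (Metric.closedBall x r)}.Nonempty := by
  obtain ⟨r, hr, h⟩ := exists_closedBall_eq_one hB
  exact ⟨r, hr, by simpa [h] using hl⟩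

theorem le_pseudoDist (hB : ∃ r, ∀ᵐ y ∂ν, dist y x ≤ r) {l t : ℝ} (hl : l < 1)
    (h : ν (Metric.ball x t) ≤ ENNReal.ofReal l) : t ≤ pseudoDist ν l x := by
  refine le_csInf (pseudoDist_set_nonempty hB hl) fun r hr => ?_
  by_contra! hrt
  exact absurd (hr.2.trans_le ((measure_mono (Metric.closedBall_subset_ball hrt)).trans h))
    (lt_irrefl _)

/-- For `l ≥ 1` the defining set is empty and `sInf` takes the default value `0`, hence the
restriction to `l < 1` and the later integrals over the open interval `Ioo 0 m`. -/
theorem monotoneOn_pseudoDist (hB : ∃ r, ∀ᵐ y ∂ν, dist y x ≤ r) :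
    MonotoneOn (fun l => pseudoDist ν l x) (Iio 1) := by
  intro l _ l' hl' hll
  exact csInf_le_csInf ⟨0, fun _ hr => hr.1.le⟩ (pseudoDist_set_nonempty hB hl')
    fun r hr => ⟨hr.1, (ENNReal.ofReal_le_ofReal hll).trans_lt hr.2⟩

theorem aemeasurable_pseudoDist (hB : ∃ r, ∀ᵐ y ∂ν, dist y x ≤ r) {m : ℝ} (hm : m ≤ 1) :
    AEMeasurable (fun l => pseudoDist ν l x) (volume.restrict (Ioo 0 m)) :=
  aemeasurable_restrict_of_monotoneOn measurableSet_Ioo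
    ((monotoneOn_pseudoDist hB).mono fun _ hl => hl.2.trans_le hm)

theorem lintegral_pseudoDist_sq_ne_top (hB : ∃ r, ∀ᵐ y ∂ν, dist y x ≤ r) {m : ℝ} (hm : m ≤ 1) :
    ∫⁻ l in Ioo 0 m, ENNReal.ofReal (pseudoDist ν l x ^ 2) ≠ ∞ := by
  obtain ⟨r, hr, h⟩ := exists_closedBall_eq_one hB
  refine ne_top_of_le_ne_top (b := ∫⁻ l in Ioo 0 m, ENNReal.ofReal (r ^ 2)) ?_ ?_
  · rw [setLIntegral_const]
    exact ENNReal.mul_ne_top ENNReal.ofReal_ne_top measure_Ioo_lt_top.ne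
  · refine setLIntegral_mono' measurableSet_Ioo fun l hl => ENNReal.ofReal_le_ofReal ?_
    have := pseudoDist_nonneg ν l x
    have : pseudoDist ν l x ≤ r := pseudoDist_le hr (by simpa [h] using hl.2.trans_le hm)
    gcongr

theorem distToMeasure_eq_toReal (hB : ∃ r, ∀ᵐ y ∂ν, dist y x ≤ r) {m : ℝ} (hm0 : 0 < m)
    (hm : m ≤ 1) :
    distToMeasure ν m x = m ^ (-(1 / 2) : ℝ) *
      ((∫⁻ l in Ioo 0 m, ENNReal.ofReal (pseudoDist ν l x ^ 2)) ^ (1 / 2 : ℝ)).toReal := by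
  rw [distToMeasure, intervalIntegral.integral_of_le hm0.le, integral_Ioc_eq_integral_Ioo,
    integral_eq_lintegral_of_nonneg_ae (ae_of_all _ fun l => sq_nonneg _)
      ((aemeasurable_pseudoDist hB hm).pow_const 2).aestronglyMeasurable,
    Real.sqrt_mul (by positivity), Real.sqrt_eq_rpow, Real.sqrt_eq_rpow, ENNReal.toReal_rpow,
    one_div m, Real.inv_rpow hm0.le, Real.rpow_neg hm0.le]

/-- With `F(t) = ν(B̄(x,t))`, the levels `l` where `δ_{ν,l}(x) > t` lie in `[F(t), m)`, of length `m
- F(t)`. Applied to a submeasure of mass `m`, this says none has a smaller second moment about `x`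
than the quantile integral. -/
theorem lintegral_pseudoDist_sq_le {Y : Type*} [MeasurableSpace Y] {η : Measure Y} {Z : Y → ℝ}
    (hB : ∃ r, ∀ᵐ y ∂ν, dist y x ≤ r) {m : ℝ} (hm : m ≤ 1) (hZ0 : ∀ y, 0 ≤ Z y)
    (hZ : Measurable Z)
    (h : ∀ t, 0 < t → ENNReal.ofReal m - ν (Metric.closedBall x t) ≤ η {y | t < Z y}) :
    ∫⁻ l in Ioo 0 m, ENNReal.ofReal (pseudoDist ν l x ^ 2) ≤ ∫⁻ y, ENNReal.ofReal (Z y ^ 2) ∂η := by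
  refine lintegral_ofReal_sq_le_of_measure_lt_le (fun l => pseudoDist_nonneg ν l x)
    (aemeasurable_pseudoDist hB hm) hZ0 hZ.aemeasurable fun t ht => le_trans ?_ (h t ht)
  have hF : ν (Metric.closedBall x t) = ENNReal.ofReal (ν.real (Metric.closedBall x t)) := by simp
  rw [Measure.restrict_apply' measurableSet_Ioo, hF, ← ENNReal.ofReal_sub _ measureReal_nonneg,
    ← Real.volume_Ico]
  refine measure_mono fun l hl => ⟨?_, hl.2.2⟩
  by_contra! hlt
  refine absurd (pseudoDist_le ht ?_) (not_le.2 hl.1)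
  rw [hF]
  exact (ENNReal.ofReal_lt_ofReal_iff (hl.2.1.trans hlt)).2 hlt

/-- The converse comparison, used for the submeasure concentrated nearest to `x`. -/
theorem le_lintegral_pseudoDist_sq {Y : Type*} [MeasurableSpace Y] {η : Measure Y} {Z : Y → ℝ}
    (hB : ∃ r, ∀ᵐ y ∂ν, dist y x ≤ r) {m : ℝ} (hm : m ≤ 1) (hZ0 : ∀ y, 0 ≤ Z y)
    (hZ : Measurable Z)
    (h : ∀ t, 0 < t → η {y | t ≤ Z y} ≤ ENNReal.ofReal m - ν (Metric.ball x t)) :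
    ∫⁻ y, ENNReal.ofReal (Z y ^ 2) ∂η ≤ ∫⁻ l in Ioo 0 m, ENNReal.ofReal (pseudoDist ν l x ^ 2) := by
  refine lintegral_ofReal_sq_le_of_measure_le_le hZ0 hZ.aemeasurable
    (fun l => pseudoDist_nonneg ν l x) (aemeasurable_pseudoDist hB hm)
    fun t ht => (h t ht).trans ?_
  have hF : ν (Metric.ball x t) = ENNReal.ofReal (ν.real (Metric.ball x t)) := by simp
  rw [Measure.restrict_apply' measurableSet_Ioo, hF, ← ENNReal.ofReal_sub _ measureReal_nonneg,
    ← Real.volume_Ioo]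
  refine measure_mono fun l hl => ⟨le_pseudoDist hB (hl.2.trans_le hm) ?_,
    measureReal_nonneg.trans_lt hl.1, hl.2⟩
  rw [hF]
  exact ENNReal.ofReal_le_ofReal hl.1.le

/-- A ball together with a fraction of its boundary sphere has any prescribed mass. -/
theorem exists_ball_add_sphere_eq (hB : ∃ r, ∀ᵐ y ∂ν, dist y x ≤ r) {m : ℝ} (hm0 : 0 < m)
    (hm : m ≤ 1) : ∃ (r : ℝ) (c : ℝ≥0∞), c ≤ 1 ∧
      ν (Metric.ball x r) + c * ν (Metric.sphere x r) = ENNReal.ofReal m := by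
  obtain ⟨r₁, hr₁, h₁⟩ := exists_closedBall_eq_one hB
  set S : Set ℝ := {r | ENNReal.ofReal m ≤ ν (Metric.closedBall x r)} with hS
  have hSne : S.Nonempty := ⟨r₁, by simpa [hS, h₁] using hm⟩
  have hSbdd : BddBelow S := ⟨0, fun r hr => by
    by_contra! hr0
    simp [hS, Metric.closedBall_eq_empty.2 hr0] at hr
    linarith⟩
  set r := sInf S
  have hup : ∀ s, r < s → ENNReal.ofReal m ≤ ν (Metric.closedBall x s) := fun s hs => by
    obtain ⟨s', hs', hlt⟩ := exists_lt_of_csInf_lt hSne hs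
    exact le_trans hs' (measure_mono (Metric.closedBall_subset_closedBall hlt.le))
  have hdown : ∀ s, s < r → ν (Metric.closedBall x s) ≤ ENNReal.ofReal m := fun s hs =>
    (not_le.1 fun h => absurd (csInf_le hSbdd h) (not_le.2 hs)).le
  obtain ⟨u, hu_anti, hu_gt, hu⟩ := exists_seq_strictAnti_tendsto r
  obtain ⟨w, hw_mono, hw_lt, hw⟩ := exists_seq_strictMono_tendsto r
  have hclosed : ENNReal.ofReal m ≤ ν (Metric.closedBall x r) := by
    have heq : Metric.closedBall x r = ⋂ n, Metric.closedBall x (u n) := by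
      ext y
      simp only [Metric.mem_closedBall, mem_iInter]
      exact ⟨fun h n => h.trans (hu_gt n).le, fun h => ge_of_tendsto' hu h⟩
    rw [heq, Antitone.measure_iInter
      (fun a b hab => Metric.closedBall_subset_closedBall (hu_anti.antitone hab))
      (fun n => Metric.isClosed_closedBall.measurableSet.nullMeasurableSet) ⟨0, measure_ne_top _ _⟩]
    exact le_iInf fun n => hup _ (hu_gt n)
  have hball : ν (Metric.ball x r) ≤ ENNReal.ofReal m := by
    have heq : Metric.ball x r = ⋃ n, Metric.closedBall x (w n) := by
      ext y
      simp only [Metric.mem_ball, Metric.mem_closedBall, mem_iUnion]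
      exact ⟨fun h => ((hw.eventually (lt_mem_nhds h)).exists).imp fun n hn => hn.le,
        fun ⟨n, hn⟩ => hn.trans_lt (hw_lt n)⟩
    rw [heq, Monotone.measure_iUnion
      (fun a b hab => Metric.closedBall_subset_closedBall (hw_mono.monotone hab))]
    exact iSup_le fun n => hdown _ (hw_lt n)
  rw [← Metric.ball_union_sphere, measure_union Metric.sphere_disjoint_ball.symm
    Metric.isClosed_sphere.measurableSet] at hclosed
  -- On a null sphere the open and closed balls have equal mass, necessarily `m`. Otherwise the
  -- fraction is the missing mass over the sphere's mass.
  rcases eq_or_ne (ν (Metric.sphere x r)) 0 with h0 | h0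
  · refine ⟨r, 0, bot_le, ?_⟩
    rw [h0, add_zero] at hclosed
    simpa using le_antisymm hball hclosed
  · refine ⟨r, (ENNReal.ofReal m - ν (Metric.ball x r)) / ν (Metric.sphere x r), ?_, ?_⟩
    · refine ENNReal.div_le_of_le_mul ?_
      rw [one_mul]
      exact tsub_le_iff_left.2 hclosed
    · rw [ENNReal.div_mul_cancel h0 (measure_ne_top _ _), add_tsub_cancel_of_le hball]

end Quantile

/-! ### Stability under the Wasserstein distance -/

section Stability

variable {X : Type*} [MeasurableSpace X] [PseudoMetricSpace X] {ν ν' : Measure X}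

theorem wasserstein2_ne_top [IsProbabilityMeasure ν] [IsProbabilityMeasure ν'] {x : X}
    (hB : ∃ r, ∀ᵐ y ∂ν, dist y x ≤ r) (hB' : ∃ r, ∀ᵐ y ∂ν', dist y x ≤ r) :
    wasserstein2 ν ν' ≠ ∞ := by
  obtain ⟨r, hr⟩ := hB
  obtain ⟨r', hr'⟩ := hB'
  refine ne_top_of_le_ne_top ?_ (iInf₂_le (ν.prod ν')
    (⟨Measure.fst_prod, Measure.snd_prod⟩ : IsTransportPlan _ _ _))
  refine ENNReal.rpow_ne_top_of_nonneg (by positivity) ?_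
  refine ne_top_of_le_ne_top (b := ∫⁻ _, ENNReal.ofReal (r + r') ^ 2 ∂(ν.prod ν'))
    (by simp) (lintegral_mono_ae ?_)
  filter_upwards [Measure.quasiMeasurePreserving_fst.ae hr,
    Measure.quasiMeasurePreserving_snd.ae hr'] with p h1 h2
  rw [edist_dist]
  gcongr
  linarith [dist_triangle_right p.1 p.2 x]

variable [OpensMeasurableSpace X]

/-- A plan has a part of mass `m` whose first marginal is the part of `ν` nearest to `x`. -/
theorem exists_partial_plan [IsProbabilityMeasure ν] {π : Measure (X × X)}
    (hπ : π.fst = ν) {x : X} (hB : ∃ r, ∀ᵐ y ∂ν, dist y x ≤ r)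
    {m : ℝ} (hm0 : 0 < m) (hm : m ≤ 1) :
    ∃ η : Measure (X × X), η ≤ π ∧ η univ = ENNReal.ofReal m ∧
      ∀ t, η {p | t ≤ dist p.1 x} ≤ ENNReal.ofReal m - ν (Metric.ball x t) := by
  obtain ⟨r, c, hc, hrc⟩ := exists_ball_add_sphere_eq hB hm0 hm
  have hmap : ∀ A, MeasurableSet A → π (Prod.fst ⁻¹' A) = ν A := fun A hA => by
    rw [← hπ, Measure.fst_apply hA]
  have hbm : MeasurableSet (Prod.fst ⁻¹' Metric.ball x r : Set (X × X)) :=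
    measurable_fst Metric.isOpen_ball.measurableSet
  have hsm : MeasurableSet (Prod.fst ⁻¹' Metric.sphere x r : Set (X × X)) :=
    measurable_fst Metric.isClosed_sphere.measurableSet
  set η : Measure (X × X) := π.restrict (Prod.fst ⁻¹' Metric.ball x r) +
    c • π.restrict (Prod.fst ⁻¹' Metric.sphere x r) with hη
  have hηuniv : η univ = ENNReal.ofReal m := by
    simp only [hη, Measure.add_apply, Measure.smul_apply, Measure.restrict_apply_univ, smul_eq_mul]
    rw [hmap _ Metric.isOpen_ball.measurableSet, hmap _ Metric.isClosed_sphere.measurableSet, hrc]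
  refine ⟨η, ?_, hηuniv, fun t => ?_⟩
  · calc η ≤ π.restrict (Prod.fst ⁻¹' Metric.ball x r) +
          (1 : ℝ≥0∞) • π.restrict (Prod.fst ⁻¹' Metric.sphere x r) := by
          rw [hη]; gcongr
      _ = π.restrict (Prod.fst ⁻¹' Metric.ball x r ∪ Prod.fst ⁻¹' Metric.sphere x r) := by
          rw [one_smul, Measure.restrict_union
            (Metric.sphere_disjoint_ball.symm.preimage _) hsm]
      _ ≤ π := Measure.restrict_le_self
  · have htm : MeasurableSet (Prod.fst ⁻¹' Metric.ball x t : Set (X × X)) :=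
      measurable_fst Metric.isOpen_ball.measurableSet
    have hcompl : {p : X × X | t ≤ dist p.1 x} = (Prod.fst ⁻¹' Metric.ball x t)ᶜ := by
      ext p; simp
    rw [hcompl]
    -- For `t ≤ r`, `η` agrees with `π` over the open `t`-ball; for `t > r`, `η` has no mass at
    -- distance `t` or more.
    rcases le_or_gt t r with htr | htr
    · refine ENNReal.le_sub_of_add_le_right (measure_ne_top _ _) ?_
      rw [← hηuniv, ← measure_add_measure_compl htm, add_comm]
      gcongr
      rw [← hmap _ Metric.isOpen_ball.measurableSet, hη, Measure.add_apply,
        Measure.restrict_apply htm, inter_eq_left.2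
          (preimage_mono (Metric.ball_subset_ball htr))]
      exact le_self_add
    · refine le_trans (le_of_eq ?_) (bot_le)
      rw [hη, Measure.add_apply, Measure.smul_apply, Measure.restrict_apply htm.compl,
        Measure.restrict_apply htm.compl, ← preimage_compl, ← preimage_inter, ← preimage_inter]
      have h1 : (Metric.ball x t)ᶜ ∩ Metric.ball x r = ∅ := by
        ext y; simp; intro h; linarith
      have h2 : (Metric.ball x t)ᶜ ∩ Metric.sphere x r = ∅ := by
        ext y; simp; intro h; linarith
      simp [h1, h2]

variable [SecondCountableTopology X]

/-- Take the part `η ≤ π` whose first marginal is nearest to `x`. Its second marginal is a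
competitor for `ν'`, and Minkowski in `L²(η)` compares the two distances to `x`. -/
theorem lintegral_pseudoDist_sq_le_add_transportCost [IsProbabilityMeasure ν]
    [IsProbabilityMeasure ν'] {π : Measure (X × X)} (hπ : IsTransportPlan π ν ν') {x : X}
    (hB : ∃ r, ∀ᵐ y ∂ν, dist y x ≤ r) (hB' : ∃ r, ∀ᵐ y ∂ν', dist y x ≤ r)
    {m : ℝ} (hm0 : 0 < m) (hm : m ≤ 1) :
    (∫⁻ l in Ioo 0 m, ENNReal.ofReal (pseudoDist ν' l x ^ 2)) ^ (1 / 2 : ℝ) ≤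
      (∫⁻ l in Ioo 0 m, ENNReal.ofReal (pseudoDist ν l x ^ 2)) ^ (1 / 2 : ℝ) +
        transportCost π := by
  obtain ⟨η, hηπ, hηm, hη⟩ := exists_partial_plan hπ.1 hB hm0 hm
  have hsq : ∀ y, ENNReal.ofReal (dist y x ^ 2) = edist y x ^ (2 : ℝ) := fun y => by
    rw [edist_dist, ENNReal.ofReal_pow dist_nonneg, ENNReal.rpow_ofNat]
  have hA := lintegral_pseudoDist_sq_le (η := η) (Z := fun p => dist p.2 x) hB' hm
    (fun _ => dist_nonneg) (by fun_prop) fun t ht => by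
      have htm : MeasurableSet {p : X × X | t < dist p.2 x} :=
        measurableSet_lt measurable_const (by fun_prop)
      rw [tsub_le_iff_right, ← hηm, ← measure_add_measure_compl htm]
      gcongr
      refine (hηπ _).trans (le_of_eq ?_)
      rw [← hπ.2, Measure.snd_apply Metric.isClosed_closedBall.measurableSet]
      congr 1
      ext p
      simp
  have hB := le_lintegral_pseudoDist_sq (η := η) (Z := fun p => dist p.1 x) hB hm
    (fun _ => dist_nonneg) (by fun_prop) fun t _ => hη t
  simp only [hsq] at hA hB
  have hmink := ENNReal.lintegral_Lp_add_le (μ := η) (p := 2)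
    (f := fun p : X × X => edist p.1 x) (g := fun p : X × X => edist p.1 p.2)
    (by fun_prop) (by fun_prop) one_le_two
  refine (ENNReal.rpow_le_rpow hA (by positivity)).trans (le_trans ?_ (hmink.trans ?_))
  · gcongr with p
    simp only [Pi.add_apply]
    rw [add_comm, edist_comm p.1 p.2]
    exact edist_triangle _ _ _
  · rw [transportCost]
    simp only [ENNReal.rpow_ofNat] at hB ⊢
    gcongr

theorem wasserstein2_comm (ν ν' : Measure X) : wasserstein2 ν ν' = wasserstein2 ν' ν := by
  suffices h : ∀ ν ν' : Measure X, wasserstein2 ν ν' ≤ wasserstein2 ν' ν from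
    le_antisymm (h _ _) (h _ _)
  intro ν ν'
  refine le_iInf₂ fun π hπ => iInf₂_le_of_le (π.map Prod.swap)
    ⟨by rw [Measure.fst_map_swap, hπ.2], by rw [Measure.snd_map_swap, hπ.1]⟩ ?_
  rw [transportCost, lintegral_map (by fun_prop) measurable_swap]
  simp [transportCost, edist_comm]

/-- Stability of the distance to a measure with respect to the Wasserstein distance. -/
theorem abs_distToMeasure_sub_le [IsProbabilityMeasure ν] [IsProbabilityMeasure ν'] {x : X}
    (hB : ∃ r, ∀ᵐ y ∂ν, dist y x ≤ r) (hB' : ∃ r, ∀ᵐ y ∂ν', dist y x ≤ r)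
    {m : ℝ} (hm0 : 0 < m) (hm : m ≤ 1) :
    |distToMeasure ν m x - distToMeasure ν' m x| ≤
      m ^ (-(1 / 2) : ℝ) * (wasserstein2 ν ν').toReal := by
  rw [distToMeasure_eq_toReal hB hm0 hm, distToMeasure_eq_toReal hB' hm0 hm, ← mul_sub, abs_mul,
    abs_of_nonneg (by positivity)]
  gcongr
  have hI := ENNReal.rpow_ne_top_of_nonneg (y := 1 / 2) (by positivity)
    (lintegral_pseudoDist_sq_ne_top hB hm)
  have hI' := ENNReal.rpow_ne_top_of_nonneg (y := 1 / 2) (by positivity)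
    (lintegral_pseudoDist_sq_ne_top hB' hm)
  have hW := wasserstein2_ne_top hB hB'
  have h1 := ENNReal.toReal_mono (ENNReal.add_ne_top.2 ⟨hI, hW⟩) (tsub_le_iff_left.1
    (le_iInf₂ fun π hπ => tsub_le_iff_left.2
      (lintegral_pseudoDist_sq_le_add_transportCost hπ hB hB' hm0 hm)))
  have hW' := hW
  rw [wasserstein2_comm] at hW'
  have h2 := ENNReal.toReal_mono (ENNReal.add_ne_top.2 ⟨hI', hW'⟩) (tsub_le_iff_left.1
    (le_iInf₂ fun π hπ => tsub_le_iff_left.2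
      (lintegral_pseudoDist_sq_le_add_transportCost hπ hB' hB hm0 hm)))
  rw [ENNReal.toReal_add hI hW] at h1
  rw [ENNReal.toReal_add hI' hW', wasserstein2_comm ν' ν] at h2
  rw [abs_le]
  constructor <;> linarith

end Stability

/-! ### Distance to the measure versus distance to the support -/

section Sandwich

variable {X : Type*} [MeasurableSpace X] [PseudoMetricSpace X] [OpensMeasurableSpace X]
  {ν : Measure X} [IsProbabilityMeasure ν] {x : X}

theorem distToMeasure_mem_Icc (hB : ∃ r, ∀ᵐ y ∂ν, dist y x ≤ r) {m a b : ℝ} (hm0 : 0 < m)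
    (hm : m ≤ 1) (ha : 0 ≤ a) (hb : 0 ≤ b)
    (h : ∀ l ∈ Ioo 0 m, pseudoDist ν l x ∈ Icc a b) : distToMeasure ν m x ∈ Icc a b := by
  have hint : IntervalIntegrable (fun l => pseudoDist ν l x ^ 2) volume 0 m := by
    rw [intervalIntegrable_iff_integrableOn_Ioo_of_le hm0.le]
    refine ⟨((aemeasurable_pseudoDist hB hm).pow_const 2).aestronglyMeasurable, ?_⟩
    rw [hasFiniteIntegral_iff_ofReal (ae_of_all _ fun l => sq_nonneg _)]
    exact (lintegral_pseudoDist_sq_ne_top hB hm).lt_top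
  have h1 : ∫ _ in (0 : ℝ)..m, a ^ 2 ≤ ∫ l in (0 : ℝ)..m, pseudoDist ν l x ^ 2 :=
    intervalIntegral.integral_mono_on_of_le_Ioo hm0.le (by simp) hint fun l hl => by
      have := (h l hl).1
      gcongr
  have h2 : ∫ l in (0 : ℝ)..m, pseudoDist ν l x ^ 2 ≤ ∫ _ in (0 : ℝ)..m, b ^ 2 :=
    intervalIntegral.integral_mono_on_of_le_Ioo hm0.le hint (by simp) fun l hl => by
      have := (h l hl).2
      have := pseudoDist_nonneg ν l x
      gcongr
  simp only [intervalIntegral.integral_const, sub_zero, smul_eq_mul] at h1 h2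
  constructor
  · refine Real.le_sqrt_of_sq_le ?_
    rw [one_div, ← div_eq_inv_mul, le_div_iff₀ hm0]
    linarith
  · refine Real.sqrt_le_iff.2 ⟨hb, ?_⟩
    rw [one_div, ← div_eq_inv_mul, div_le_iff₀ hm0]
    linarith

theorem abs_infDist_sub_distToMeasure_le (hB : ∃ r, ∀ᵐ y ∂ν, dist y x ≤ r) {m K : ℝ}
    (hm0 : 0 < m) (hm : m ≤ 1) {M : Set X} (hMc : IsCompact M) (hM : ∀ᵐ y ∂ν, y ∈ M)
    (hK : 0 ≤ K)
    (h : ∀ y ∈ M, ∀ l s : ℝ, l ∈ Ioo 0 m → K < s → ENNReal.ofReal l < ν (Metric.closedBall y s)) :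
    |Metric.infDist x M - distToMeasure ν m x| ≤ K := by
  have hd : 0 ≤ Metric.infDist x M := Metric.infDist_nonneg
  have hmem := distToMeasure_mem_Icc (a := Metric.infDist x M) (b := Metric.infDist x M + K)
    hB hm0 hm hd (by positivity) fun l hl => ⟨le_pseudoDist hB (hl.2.trans_le hm) ?_, ?_⟩
  · rw [abs_le]
    constructor <;> linarith [hmem.1, hmem.2]
  · refine le_trans (le_of_eq ?_) bot_le
    exact measure_mono_null Metric.disjoint_ball_infDist.subset_compl_right (mem_ae_iff.1 hM)
  · obtain ⟨z, hz⟩ := hM.exists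
    obtain ⟨y, hy, hxy⟩ := hMc.exists_infDist_eq_dist ⟨z, hz⟩ x
    -- The slack `ε` is needed because the mass bound `h` holds only for radii strictly above `K`.
    refine le_of_forall_pos_le_add fun ε hε => pseudoDist_le (by positivity) ?_
    refine (h y hy l (K + ε) hl (by linarith)).trans_le (measure_mono ?_)
    refine Metric.closedBall_subset_closedBall' ?_
    rw [dist_comm, ← hxy]
    linarith

end Sandwich

/-! ### Mixtures and empirical measures -/

section Mixture

variable {X : Type*} [MeasurableSpace X]

theorem isProbabilityMeasure_mixture {α : ℝ} (h0 : 0 ≤ α) (h1 : α ≤ 1) (μ ν : Measure X)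
    [IsProbabilityMeasure μ] [IsProbabilityMeasure ν] : IsProbabilityMeasure (mixture α μ ν) := by
  constructor
  simp [mixture, ← ENNReal.ofReal_add (sub_nonneg.2 h1) h0]

theorem isProbabilityMeasure_empiricalMeasure {n : ℕ} (hn : 1 ≤ n) (x : Fin n → X) :
    IsProbabilityMeasure (empiricalMeasure x) := by
  constructor
  simp only [empiricalMeasure, Measure.smul_apply, Measure.finsetSum_apply, measure_univ,
    Finset.sum_const, Finset.card_univ, Fintype.card_fin, nsmul_eq_mul, mul_one, smul_eq_mul]
  exact ENNReal.inv_mul_cancel (by simp; omega) (by simp)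

variable [PseudoMetricSpace X]

theorem ae_dist_le_mixture {α : ℝ} {μ ν : Measure X} {x : X}
    (hμ : ∃ r, ∀ᵐ y ∂μ, dist y x ≤ r) (hν : ∃ r, ∀ᵐ y ∂ν, dist y x ≤ r) :
    ∃ r, ∀ᵐ y ∂(mixture α μ ν), dist y x ≤ r := by
  obtain ⟨r, hr⟩ := hμ
  obtain ⟨s, hs⟩ := hν
  refine ⟨max r s, ?_⟩
  rw [mixture, ae_add_measure_iff]
  exact ⟨Measure.ae_smul_measure (hr.mono fun y hy => hy.trans (le_max_left _ _)) _,
    Measure.ae_smul_measure (hs.mono fun y hy => hy.trans (le_max_right _ _)) _⟩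

theorem ae_dist_le_empiricalMeasure [OpensMeasurableSpace X] {n : ℕ} (z : Fin n → X) (x : X) :
    ∃ r, ∀ᵐ y ∂(empiricalMeasure z), dist y x ≤ r := by
  refine ⟨∑ i, dist (z i) x, Measure.ae_smul_measure ?_ _⟩
  have hmeas : MeasurableSet {y | ¬ dist y x ≤ ∑ i, dist (z i) x} :=
    (Metric.isClosed_closedBall (x := x)).measurableSet.compl
  rw [ae_iff, Measure.finsetSum_apply]
  refine Finset.sum_eq_zero fun i _ => ?_
  rw [Measure.dirac_apply' _ hmeas]
  refine indicator_of_notMem (not_not_intro ?_) _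
  exact Finset.single_le_sum (f := fun i => dist (z i) x) (fun _ _ => dist_nonneg)
    (Finset.mem_univ i)

/-- Leave mass `1 - α` in place along the diagonal, at no cost, and move the rest by a plan from `μ`
to `ν`. -/
theorem wasserstein2_mixture_le [OpensMeasurableSpace X] [SecondCountableTopology X] {α : ℝ}
    (h0 : 0 ≤ α) (h1 : α ≤ 1) (μ ν : Measure X)
    [IsProbabilityMeasure μ] [IsProbabilityMeasure ν] :
    wasserstein2 μ (mixture α μ ν) ≤ ENNReal.ofReal α ^ (1 / 2 : ℝ) * wasserstein2 μ ν := by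
  have hsum : ENNReal.ofReal (1 - α) + ENNReal.ofReal α = 1 := by
    simp [← ENNReal.ofReal_add (sub_nonneg.2 h1) h0]
  have hplan : ∀ π : Measure (X × X), IsTransportPlan π μ ν →
      wasserstein2 μ (mixture α μ ν) ≤ ENNReal.ofReal α ^ (1 / 2 : ℝ) * transportCost π := by
    intro π hπ
    have hdiag : Measurable fun x : X => (x, x) := by fun_prop
    refine iInf₂_le_of_le (ENNReal.ofReal (1 - α) • μ.map (fun x => (x, x)) +
      ENNReal.ofReal α • π) ⟨?_, ?_⟩ ?_
    · rw [Measure.fst, Measure.map_add _ _ measurable_fst, Measure.map_smul, Measure.map_smul,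
        Measure.map_map measurable_fst hdiag, ← Measure.fst, hπ.1]
      change ENNReal.ofReal (1 - α) • μ.map id + _ = _
      rw [Measure.map_id, ← add_smul, hsum, one_smul]
    · rw [Measure.snd, Measure.map_add _ _ measurable_snd, Measure.map_smul, Measure.map_smul,
        Measure.map_map measurable_snd hdiag, ← Measure.snd, hπ.2]
      change ENNReal.ofReal (1 - α) • μ.map id + _ = _
      rw [Measure.map_id, mixture]
    · rw [transportCost, lintegral_add_measure, lintegral_smul_measure, lintegral_smul_measure,
        lintegral_map (by fun_prop) hdiag, transportCost,
        ← ENNReal.mul_rpow_of_nonneg _ _ (by positivity)]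
      simp
  -- Passing to the infimum over plans divides by this factor. When it vanishes, one plan is enough,
  -- since `0 * ∞ = 0`.
  rcases eq_or_ne (ENNReal.ofReal α ^ (1 / 2 : ℝ)) 0 with ha | ha
  · refine (hplan (μ.prod ν) ⟨Measure.fst_prod, Measure.snd_prod⟩).trans ?_
    rw [ha, zero_mul, zero_mul]
  · have htop : ENNReal.ofReal α ^ (1 / 2 : ℝ) ≠ ∞ :=
      ENNReal.rpow_ne_top_of_nonneg (by positivity) ENNReal.ofReal_ne_top
    rw [← ENNReal.div_le_iff' ha htop]
    exact le_iInf₂ fun π hπ => (ENNReal.div_le_iff' ha htop).2 (hplan π hπ)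

end Mixture

/-! ### The uniform measure on a ball and the final estimate -/

theorem isProbabilityMeasure_uniformBall {d : ℕ} (c : EuclideanSpace ℝ (Fin d)) {R : ℝ}
    (hR : 0 < R) : IsProbabilityMeasure (uniformBall c R) :=
  ProbabilityTheory.cond_isProbabilityMeasure_of_finite
    (Metric.measure_closedBall_pos _ _ hR).ne' measure_closedBall_lt_top.ne

theorem ae_mem_uniformBall {d : ℕ} (c : EuclideanSpace ℝ (Fin d)) (R : ℝ) :
    ∀ᵐ y ∂(uniformBall c R), y ∈ Metric.closedBall c R :=
  ProbabilityTheory.ae_cond_mem Metric.isClosed_closedBall.measurableSet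

theorem mainTheorem5 (d d' : ℕ) (hd' : 1 ≤ d')
    (M : Set (EuclideanSpace ℝ (Fin d))) (hMc : IsCompact M)
    (hM : IsSubmanifoldWithBoundary d' M)
    (μ : Measure (EuclideanSpace ℝ (Fin d))) [IsProbabilityMeasure μ]
    (hsupp : μ.support = M) (hdens : DensityBoundedBelow d' M μ) :
    ∃ C : ℝ, 0 < C ∧
      ∀ (c : EuclideanSpace ℝ (Fin d)) (R : ℝ), 0 < R → M ⊆ Metric.closedBall c R →
      ∀ (n : ℕ), 1 ≤ n →
      ∀ (α m : ℝ), 0 ≤ α → α ≤ 1 → 0 < m → m ≤ 1 →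
      ∀ (Ω : Type*) [MeasurableSpace Ω] (P : Measure Ω) [IsProbabilityMeasure P]
        (X : Fin n → Ω → EuclideanSpace ℝ (Fin d)),
        (∀ i, Measurable (X i)) → ProbabilityTheory.iIndepFun X P →
        (∀ i, P.map (X i) = mixture α μ (uniformBall c R)) →
      ∀ (ω : Ω) (x : EuclideanSpace ℝ (Fin d)),
        |Metric.infDist x M - distToMeasure (empiricalMeasure fun i => X i ω) m x| ≤
          C ^ (1 / (d' : ℝ)) * m ^ (1 / (d' : ℝ))
            + (α / m) ^ (1 / 2 : ℝ) * (wasserstein2 μ (uniformBall c R)).toReal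
            + m ^ (-(1 / 2) : ℝ) *
              (wasserstein2 (mixture α μ (uniformBall c R))
                (empiricalMeasure fun i => X i ω)).toReal := by
  have hMμ : ∀ᵐ y ∂μ, y ∈ M := hsupp ▸ Measure.support_mem_ae
  obtain ⟨C, hC, hball⟩ := hdens.exists_lt_measure_closedBall hd' hMc hM hMμ
  refine ⟨C, hC, fun c R hR hMR n hn α m hα0 hα1 hm0 hm Ω _ P _ X _ _ _ ω x => ?_⟩
  have hd0 : d' ≠ 0 := by omega
  have := isProbabilityMeasure_uniformBall c hR
  have := isProbabilityMeasure_mixture hα0 hα1 μ (uniformBall c R)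
  have := isProbabilityMeasure_empiricalMeasure hn fun i => X i ω
  have hdist : ∀ y ∈ Metric.closedBall c R, dist y x ≤ R + dist c x := fun y hy =>
    (dist_triangle y c x).trans (add_le_add_left (Metric.mem_closedBall.1 hy) _)
  have hBμ : ∃ r, ∀ᵐ y ∂μ, dist y x ≤ r := ⟨_, hMμ.mono fun y hy => hdist y (hMR hy)⟩
  have hBR : ∃ r, ∀ᵐ y ∂(uniformBall c R), dist y x ≤ r :=
    ⟨_, (ae_mem_uniformBall c R).mono fun y hy => hdist y hy⟩
  have hBmix : ∃ r, ∀ᵐ y ∂(mixture α μ (uniformBall c R)), dist y x ≤ r :=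
    ae_dist_le_mixture hBμ hBR
  have hBemp := ae_dist_le_empiricalMeasure (fun i => X i ω) x
  have h1 : |Metric.infDist x M - distToMeasure μ m x| ≤
      C ^ (1 / (d' : ℝ)) * m ^ (1 / (d' : ℝ)) := by
    refine abs_infDist_sub_distToMeasure_le hBμ hm0 hm hMc hMμ (by positivity)
      fun y hy l s hl hs => hball y hy l s hl.1 (hl.2.trans_le hm)
        (lt_of_le_of_lt (by positivity) hs) ?_
    calc C * l ≤ C * m := by gcongr; exact hl.2.le
      _ = (C ^ (1 / (d' : ℝ)) * m ^ (1 / (d' : ℝ))) ^ d' := by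
          rw [mul_pow, one_div, Real.rpow_inv_natCast_pow hC.le hd0,
            Real.rpow_inv_natCast_pow hm0.le hd0]
      _ < s ^ d' := by gcongr
  have h2 : |distToMeasure μ m x - distToMeasure (mixture α μ (uniformBall c R)) m x| ≤
      (α / m) ^ (1 / 2 : ℝ) * (wasserstein2 μ (uniformBall c R)).toReal := by
    refine (abs_distToMeasure_sub_le hBμ hBmix hm0 hm).trans ?_
    have hW := ENNReal.toReal_mono (ENNReal.mul_ne_top (ENNReal.rpow_ne_top_of_nonneg
      (by positivity) ENNReal.ofReal_ne_top) (wasserstein2_ne_top hBμ hBR))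
      (wasserstein2_mixture_le hα0 hα1 μ (uniformBall c R))
    rw [ENNReal.toReal_mul, ← ENNReal.toReal_rpow, ENNReal.toReal_ofReal hα0] at hW
    calc _ ≤ m ^ (-(1 / 2) : ℝ) *
          (α ^ (1 / 2 : ℝ) * (wasserstein2 μ (uniformBall c R)).toReal) := by gcongr
      _ = _ := by
          rw [Real.div_rpow hα0 hm0.le, Real.rpow_neg hm0.le]
          ring
  have h3 := abs_distToMeasure_sub_le hBmix hBemp hm0 hm
  calc _ ≤ |Metric.infDist x M - distToMeasure μ m x| +
        |distToMeasure μ m x - distToMeasure (mixture α μ (uniformBall c R)) m x| +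
        |distToMeasure (mixture α μ (uniformBall c R)) m x -
          distToMeasure (empiricalMeasure fun i => X i ω) m x| :=
        (abs_sub_le _ _ _).trans (add_le_add_left (abs_sub_le _ _ _) _)
    _ ≤ _ := add_le_add (add_le_add h1 h2) h3
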